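/- Let $d\ge 1$ be a fixed integer. For points $V=\{x_1,\dots,x_n\}\subset\mathbb R^d$ and a simple undirected graph $G=(V,E)$, let $r_i=\max\{\|x_ix_j\| : x_ix_j\in E\}$ (and $r_i=0$ if $x_i$ is isolated), let $B_i$ be the closed Euclidean ball with center $x_i$ and radius $r_i$, and let the interference of $G$ be $I(G)=\max_{x\in V}|\{i : x\in B_i\}|$. Let $\ell=\ell(G)$ be the length of the longest edge of $G$ ($\ell=0$ if $G$ has no edge). Let $\mathcal T(V)$ be the class of all graphs $G$ with vertex set $V$ such that for every two edges $a_1a_2$ and $b_1b_2$ of $G$ (possibly sharing vertices, with either labelling of their endpoints) \[ \|a_1a_2\|\le\max\{\|a_1b_1\|,\ \|b_1b_2\|,\ \|b_2a_2\|\}; \] this class contains every Euclidean minimum spanning tree of $V$. There is a constant $C>0$, depending only on $d$, such that if $V$ is a set of $n$ points independently and uniformly distributed in $[0,1]^d$, then, with probability tending to $1$ as $n\to\infty$, every graph $G\in\mathcal T(V)$ satisfies \[ I(G)\le C\left((\log n)^{1/2}+\log^+\!\left(\ell(G)\, n^{1/d}\right)\right), \qquad \log^+ t=\max\{0,\log t\}\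 (\log^+0=0). \] -/

import Mathlib

open MeasureTheory Filter Topology

noncomputable section

namespace RandomInterference

/-- The points of `ℝ^d`, with the Euclidean distance. -/
abbrev Pt (d : ℕ) : Type := EuclideanSpace ℝ (Fin d)

/-- The unit cube `[0,1]^d`. -/
def unitCube (d : ℕ) : Set (Pt d) := {p | ∀ i, p i ∈ Set.Icc (0 : ℝ) 1}

/-- The joint law of `n` independent points, each uniformly distributed in `[0,1]^d`. -/
def uniformSample (d n : ℕ) : Measure (Fin n → Pt d) :=
  Measure.pi fun _ => (volume : Measure (Pt d)).restrict (unitCube d)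

variable {d n : ℕ}

/-- The radius of the ball at vertex `i`: the length of a longest edge of `G` at `i`
(and `0` if `i` is isolated). The point of vertex `i` is `x i`. -/
def radius (x : Fin n → Pt d) (G : SimpleGraph (Fin n)) (i : Fin n) : ℝ :=
  sSup ((fun j => dist (x i) (x j)) '' G.neighborSet i)

/-- The closed ball `B_i` of `G` at vertex `i`. -/
def nodeBall (x : Fin n → Pt d) (G : SimpleGraph (Fin n)) (i : Fin n) : Set (Pt d) :=
  Metric.closedBall (x i) (radius x G i)

/-- The interference at a point `p`: the number of balls of `G` that contain `p`. -/
def interferenceAt (x : Fin n → Pt d) (G : SimpleGraph (Fin n)) (p : Pt d) : ℕ :=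
  {i : Fin n | p ∈ nodeBall x G i}.ncard

/-- The maximum receiver-centric interference of `G`: the maximum over the vertices of the
interference at that vertex. -/
def interference (x : Fin n → Pt d) (G : SimpleGraph (Fin n)) : ℕ :=
  Finset.univ.sup fun k => interferenceAt x G (x k)

/-- The length of a longest edge of `G` (and `0` if `G` has no edge). -/
def longestEdge (x : Fin n → Pt d) (G : SimpleGraph (Fin n)) : ℝ :=
  sSup {t : ℝ | ∃ i j, G.Adj i j ∧ t = dist (x i) (x j)}

/-- The class `𝒯(V)` of Khabbazian, Durocher and Haghnegahdar, for `V = {x 0, …, x (n - 1)}`: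
an edge `a₁a₂` of `G` is never strictly longer than all three hops of a path `a₁, b₁, b₂, a₂`
whose middle hop `b₁b₂` is an edge of `G`. The two edges may share vertices. Connectedness of
`G` is not required. -/
def localMSTClass (x : Fin n → Pt d) : Set (SimpleGraph (Fin n)) :=
  {G | ∀ a₁ a₂ b₁ b₂ : Fin n, G.Adj a₁ a₂ → G.Adj b₁ b₂ →
    dist (x a₁) (x a₂) ≤
      max (dist (x a₁) (x b₁)) (max (dist (x b₁) (x b₂)) (dist (x b₂) (x a₂)))}

end RandomInterference

end

namespace RandomInterference

/-! Sort the balls containing a vertex by the dyadic scale of their radii. Each scale contributes at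
most `K` balls (`exists_scale_bound`): by a packing argument, too many would give two long edges
with nearby endpoints, which the defining inequality of the class and general position forbid. It
remains to count occupied scales.

Put `τ = ε n^(-1/d)`. Above `τ` the longest edge leaves about `log₂ (ℓ/τ)` scales. Below `τ`, each
occupied scale supplies a ball centre near the vertex, so `m` occupied scales give `m` neighbours
within `τ, τ/2, τ/4, …`. A union bound makes this have probability at most `n · 2^(-m(m-1)/2)`,
which tends to 0 once `m` is about `2 √(log n)`. -/

/-! ### The uniform law and its conditioning on one point. -/

theorem measurableSet_unitCube (d : ℕ) : MeasurableSet (unitCube d) := by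
  have h : unitCube d = ⋂ i, (fun p : Pt d => p i) ⁻¹' Set.Icc (0 : ℝ) 1 := by
    ext p; simp [unitCube]
  rw [h]
  exact MeasurableSet.iInter fun i => measurableSet_Icc.preimage (by fun_prop)

theorem volume_unitCube (d : ℕ) : volume (unitCube d) = 1 := by
  have h : unitCube d = (MeasurableEquiv.toLp 2 (Fin d → ℝ)).symm ⁻¹'
      Set.Icc (fun _ => (0 : ℝ)) (fun _ => 1) := by
    ext p
    simp [unitCube, Pi.le_def, forall_and]
  rw [h, (EuclideanSpace.volume_preserving_symm_measurableEquiv_toLp (Fin d)).measure_preimage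
    measurableSet_Icc.nullMeasurableSet, Real.volume_Icc_pi]
  simp

instance isProbabilityMeasure_restrict_unitCube (d : ℕ) :
    IsProbabilityMeasure ((volume : Measure (Pt d)).restrict (unitCube d)) :=
  ⟨by simp [volume_unitCube]⟩

instance isProbabilityMeasure_uniformSample (d n : ℕ) :
    IsProbabilityMeasure (uniformSample d n) := by
  unfold uniformSample; infer_instance

/-- Resolving one of the sample points: the law of the sample is the product of the law of the
`i`-th point and of the law of the others. -/
theorem measurePreserving_split (d n : ℕ) (i : Fin (n + 1)) :
    MeasurePreserving (MeasurableEquiv.piFinSuccAbove (fun _ : Fin (n + 1) => Pt d) i)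
      (uniformSample d (n + 1))
      (((volume : Measure (Pt d)).restrict (unitCube d)).prod (uniformSample d n)) :=
  measurePreserving_piFinSuccAbove (fun _ => (volume : Measure (Pt d)).restrict (unitCube d)) i

/-- The probability that given distinct points lie within prescribed distances of a given one
is at most the product of the volumes of the corresponding balls. -/
theorem uniformSample_near_le (d n : ℕ) {m : ℕ} (k : Fin (n + 1)) (f : Fin m ↪ Fin n)
    (ρ : Fin m → ℝ) :
    uniformSample d (n + 1) {x | ∀ j, dist (x (k.succAbove (f j))) (x k) ≤ ρ j} ≤
      ∏ j, volume (Metric.closedBall (0 : Pt d) (ρ j)) := by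
  set S : Set (Pt d × (Fin n → Pt d)) := {q | ∀ j, dist (q.2 (f j)) q.1 ≤ ρ j} with hS
  have hmeas : MeasurableSet S := by
    have : S = ⋂ j, {q | dist (q.2 (f j)) q.1 ≤ ρ j} := by ext; simp [hS]
    rw [this]
    exact MeasurableSet.iInter fun j => measurableSet_le (by fun_prop) (by fun_prop)
  have hpre : {x : Fin (n + 1) → Pt d | ∀ j, dist (x (k.succAbove (f j))) (x k) ≤ ρ j} =
      MeasurableEquiv.piFinSuccAbove (fun _ : Fin (n + 1) => Pt d) k ⁻¹' S := rfl
  rw [hpre, (measurePreserving_split d n k).measure_preimage hmeas.nullMeasurableSet,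
    Measure.prod_apply hmeas]
  have hsec : ∀ p : Pt d, uniformSample d n (Prod.mk p ⁻¹' S) ≤
      ∏ j, volume (Metric.closedBall (0 : Pt d) (ρ j)) := by
    intro p
    classical
    -- For `i` outside the range of `f` the intersection is empty, hence the whole space, so the
    -- slice is a full product set.
    let s : Fin n → Set (Pt d) := fun i => ⋂ j, ⋂ (_ : f j = i), Metric.closedBall p (ρ j)
    have h1 : Prod.mk p ⁻¹' S = Set.univ.pi s := by
      ext y
      simp only [hS, s, Set.mem_preimage, Set.mem_ofPred_eq, Set.mem_pi, Set.mem_univ,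
        forall_true_left, Set.mem_iInter, Metric.mem_closedBall]
      exact ⟨fun h i j hj => hj ▸ h j, fun h j => h _ j rfl⟩
    rw [h1, uniformSample, Measure.pi_pi]
    calc ∏ i, (volume.restrict (unitCube d)) (s i)
        ≤ ∏ i ∈ Finset.univ.map f, (volume.restrict (unitCube d)) (s i) := by
          apply Finset.prod_le_prod_of_subset_of_le_one' (Finset.subset_univ _)
          intro i _ _
          exact prob_le_one
      _ = ∏ j, (volume.restrict (unitCube d)) (s (f j)) := by rw [Finset.prod_map]
      _ ≤ ∏ j, volume (Metric.closedBall (0 : Pt d) (ρ j)) := by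
          refine Finset.prod_le_prod' fun j _ => ?_
          calc (volume.restrict (unitCube d)) (s (f j)) ≤ volume (s (f j)) :=
                Measure.restrict_apply_le _ _
            _ ≤ volume (Metric.closedBall p (ρ j)) :=
                measure_mono (Set.iInter₂_subset (s := fun j' _ => Metric.closedBall p (ρ j')) j rfl)
            _ = _ := Measure.addHaar_closedBall_center _ _ _
  calc _ ≤ ∫⁻ _, ∏ j, volume (Metric.closedBall (0 : Pt d) (ρ j))
        ∂((volume : Measure (Pt d)).restrict (unitCube d)) := lintegral_mono hsec
    _ = _ := by simp

/-! ### General position. -/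

/-- Points in general position: two edges of the same length have the same endpoints. -/
def GeneralPosition {d n : ℕ} (x : Fin n → Pt d) : Prop :=
  ∀ i j k l, i ≠ j → i ≠ k → i ≠ l → dist (x i) (x j) ≠ dist (x k) (x l)

theorem GeneralPosition.injective {d n : ℕ} {x : Fin n → Pt d} (hx : GeneralPosition x) :
    Function.Injective x := by
  intro i j hij
  by_contra h
  exact hx i j j j h h h (by simp [hij])

/-- With all other points frozen, `x i` is confined to a sphere of fixed centre and radius, a null
set when `d ≥ 1`. -/
theorem uniformSample_dist_eq (d n : ℕ) (hd : 1 ≤ d) (i j k l : Fin n) (hj : i ≠ j)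
    (hk : i ≠ k) (hl : i ≠ l) :
    uniformSample d n {x | dist (x i) (x j) = dist (x k) (x l)} = 0 := by
  obtain _ | n := n
  · exact i.elim0
  have : Nonempty (Fin d) := ⟨⟨0, hd⟩⟩
  obtain ⟨j, rfl⟩ := Fin.exists_succAbove_eq hj.symm
  obtain ⟨k, rfl⟩ := Fin.exists_succAbove_eq hk.symm
  obtain ⟨l, rfl⟩ := Fin.exists_succAbove_eq hl.symm
  set S : Set (Pt d × (Fin n → Pt d)) := {q | dist q.1 (q.2 j) = dist (q.2 k) (q.2 l)} with hS
  have hmeas : MeasurableSet S := measurableSet_eq_fun (by fun_prop) (by fun_prop)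
  have hpre : {x : Fin (n + 1) → Pt d | dist (x i) (x (i.succAbove j)) =
      dist (x (i.succAbove k)) (x (i.succAbove l))} =
      MeasurableEquiv.piFinSuccAbove (fun _ : Fin (n + 1) => Pt d) i ⁻¹' S := rfl
  rw [hpre, (measurePreserving_split d n i).measure_preimage hmeas.nullMeasurableSet,
    Measure.prod_apply_symm hmeas, lintegral_eq_zero_of_ae_eq_zero]
  refine Eventually.of_forall fun y => ?_
  refine le_antisymm ((Measure.restrict_apply_le _ _).trans ?_) zero_le
  exact (Measure.addHaar_sphere (volume : Measure (Pt d)) (y j) (dist (y k) (y l))).le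

theorem uniformSample_not_generalPosition (d n : ℕ) (hd : 1 ≤ d) :
    uniformSample d n {x | ¬ GeneralPosition x} = 0 := by
  have : ∀ᵐ x ∂(uniformSample d n), GeneralPosition x := by
    simp only [GeneralPosition, ae_all_iff]
    intro i j k l hj hk hl
    simpa [ae_iff] using uniformSample_dist_eq d n hd i j k l hj hk hl
  simpa [ae_iff] using this

/-! ### Nested neighbours are unlikely. -/

theorem exists_volume_closedBall_le (d : ℕ) (hd : 1 ≤ d) :
    ∃ ε : ℝ, 0 < ε ∧ ∀ t : ℝ, 0 ≤ t →
      volume (Metric.closedBall (0 : Pt d) (ε * t)) ≤ ENNReal.ofReal (t ^ d) := by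
  have hfin : volume (Metric.ball (0 : Pt d) 1) ≠ ⊤ := measure_ball_lt_top.ne
  set v := (volume (Metric.ball (0 : Pt d) 1)).toReal
  have hv : 0 ≤ v := ENNReal.toReal_nonneg
  -- This `ε` satisfies both `ε ^ d ≤ ε` and `ε * v ≤ 1`.
  refine ⟨1 / (v + 1), by positivity, fun t ht => ?_⟩
  rw [Measure.addHaar_closedBall _ _ (by positivity), ← ENNReal.ofReal_toReal hfin,
    ← ENNReal.ofReal_mul (by positivity)]
  apply ENNReal.ofReal_le_ofReal
  rw [finrank_euclideanSpace_fin, mul_pow, mul_right_comm]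
  have h1 : (1 / (v + 1)) ^ d ≤ 1 / (v + 1) :=
    pow_le_of_le_one (by positivity) (by rw [div_le_one (by positivity)]; linarith) (by omega)
  have h2 : (1 / (v + 1)) ^ d * v ≤ 1 := by
    calc _ ≤ 1 / (v + 1) * v := by gcongr
      _ ≤ 1 := by rw [one_div_mul_eq_div, div_le_one (by positivity)]; linarith
  exact mul_le_of_le_one_left (by positivity) h2

/-- Some point of the sample has `m` other points at geometrically decreasing distances. -/
def HasNestedNeighbors {d n : ℕ} (x : Fin n → Pt d) (τ : ℝ) (m : ℕ) : Prop :=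
  ∃ (k : Fin n) (f : Fin m → Fin n), Function.Injective f ∧ (∀ j, f j ≠ k) ∧
    ∀ j, dist (x (f j)) (x k) ≤ τ * (1 / 2) ^ (j : ℕ)

/-- Union bound: the at most `n ^ m` choices of neighbours cancel the factors `1 / n` in the ball
volumes, leaving `n` centres and the product of the `2 ^ (-j)`. -/
theorem uniformSample_hasNestedNeighbors_le (d n m : ℕ) (hd : 1 ≤ d) {ε τ : ℝ} (hτ : 0 ≤ τ)
    (hτd : τ ^ d ≤ 1 / n)
    (hε : ∀ t : ℝ, 0 ≤ t →
      volume (Metric.closedBall (0 : Pt d) (ε * t)) ≤ ENNReal.ofReal (t ^ d)) :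
    uniformSample d n {x | HasNestedNeighbors x (ε * τ) m} ≤
      ENNReal.ofReal (n * (1 / 2) ^ (m * (m - 1) / 2)) := by
  obtain _ | n := n
  · have : {x : Fin 0 → Pt d | HasNestedNeighbors x (ε * τ) m} = ∅ := by
      ext x
      simp only [Set.mem_ofPred_eq, Set.mem_empty_iff_false, iff_false]
      rintro ⟨k, -⟩
      exact k.elim0
    simp [this]
  have hsub : {x : Fin (n + 1) → Pt d | HasNestedNeighbors x (ε * τ) m} ⊆
      ⋃ (k : Fin (n + 1)), ⋃ (f : Fin m ↪ Fin n),
        {x | ∀ j, dist (x (k.succAbove (f j))) (x k) ≤ ε * τ * (1 / 2) ^ (j : ℕ)} := by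
    rintro x ⟨k, f, hf, hk, hx⟩
    choose g hg using fun j => Fin.exists_succAbove_eq (hk j)
    refine Set.mem_iUnion₂.2 ⟨k, ⟨g, fun a b hab => hf ?_⟩, fun j => ?_⟩
    · rw [← hg, ← hg, hab]
    · have := hx j
      rwa [← hg j] at this
  have hprod : ∀ (k : Fin (n + 1)) (f : Fin m ↪ Fin n),
      uniformSample d (n + 1)
        {x | ∀ j, dist (x (k.succAbove (f j))) (x k) ≤ ε * τ * (1 / 2) ^ (j : ℕ)} ≤
      ENNReal.ofReal ((1 / (n + 1)) ^ m * (1 / 2) ^ (m * (m - 1) / 2)) := by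
    intro k f
    refine (uniformSample_near_le d n k f _).trans ?_
    calc ∏ j : Fin m, volume (Metric.closedBall (0 : Pt d) (ε * τ * (1 / 2) ^ (j : ℕ)))
        ≤ ∏ j : Fin m, ENNReal.ofReal (1 / (n + 1) * (1 / 2) ^ (j : ℕ)) := by
          refine Finset.prod_le_prod' fun j _ => ?_
          rw [mul_assoc]
          refine (hε _ (by positivity)).trans (ENNReal.ofReal_le_ofReal ?_)
          rw [mul_pow]
          push_cast at hτd
          gcongr
          -- The power `d` on `2 ^ (-j)` is discarded, so the bound is free of the dimension.
          exact pow_le_of_le_one (by positivity) (pow_le_one₀ (by norm_num) (by norm_num))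
            (by omega)
      _ = _ := by
          rw [← ENNReal.ofReal_prod_of_nonneg (fun j _ => by positivity),
            Finset.prod_mul_distrib, Finset.prod_const, Finset.card_univ, Fintype.card_fin,
            Fin.prod_univ_eq_prod_range (fun j => (1 / 2 : ℝ) ^ j), Finset.prod_pow_eq_pow_sum,
            Finset.sum_range_id]
  calc uniformSample d (n + 1) {x | HasNestedNeighbors x (ε * τ) m}
      ≤ _ := measure_mono hsub
    _ ≤ ∑ k : Fin (n + 1), ∑ f : Fin m ↪ Fin n, uniformSample d (n + 1)
          {x | ∀ j, dist (x (k.succAbove (f j))) (x k) ≤ ε * τ * (1 / 2) ^ (j : ℕ)} :=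
        (measure_iUnion_fintype_le _ _).trans
          (Finset.sum_le_sum fun k _ => measure_iUnion_fintype_le _ _)
    _ ≤ ∑ k : Fin (n + 1), ∑ f : Fin m ↪ Fin n,
          ENNReal.ofReal ((1 / (n + 1)) ^ m * (1 / 2) ^ (m * (m - 1) / 2)) :=
        Finset.sum_le_sum fun k _ => Finset.sum_le_sum fun f _ => hprod k f
    _ = ENNReal.ofReal (((n + 1 : ℕ) : ℝ) * (n.descFactorial m *
          ((1 / (n + 1)) ^ m * (1 / 2) ^ (m * (m - 1) / 2)))) := by
        simp only [Finset.sum_const, Finset.card_univ, Fintype.card_fin,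
          Fintype.card_embedding_eq, nsmul_eq_mul]
        rw [ENNReal.ofReal_mul (Nat.cast_nonneg _), ENNReal.ofReal_mul (Nat.cast_nonneg _),
          ENNReal.ofReal_natCast, ENNReal.ofReal_natCast]
    _ ≤ _ := by
        apply ENNReal.ofReal_le_ofReal
        gcongr
        rw [← mul_assoc]
        apply mul_le_of_le_one_left (by positivity)
        have h1 : (n.descFactorial m : ℝ) ≤ (n + 1 : ℝ) ^ m := by
          exact_mod_cast (Nat.descFactorial_le_pow n m).trans (Nat.pow_le_pow_left n.le_succ m)
        rw [one_div, inv_pow, ← div_eq_mul_inv]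
        exact div_le_one_of_le₀ h1 (by positivity)

/-! ### Boundedly many balls per scale. -/

theorem exists_adj_dist_eq_radius {d n : ℕ} (x : Fin n → Pt d) (G : SimpleGraph (Fin n))
    {i : Fin n} (h : 0 < radius x G i) : ∃ j, G.Adj i j ∧ dist (x i) (x j) = radius x G i := by
  have hne : ((fun j => dist (x i) (x j)) '' G.neighborSet i).Nonempty := by
    rw [Set.nonempty_iff_ne_empty]
    intro h0
    rw [radius, h0, Real.sSup_empty] at h
    exact h.false
  obtain ⟨j, hj, hj'⟩ := hne.csSup_mem ((Set.toFinite _).image _)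
  exact ⟨j, hj, hj'⟩

theorem dist_le_longestEdge {d n : ℕ} (x : Fin n → Pt d) (G : SimpleGraph (Fin n)) {i j : Fin n}
    (h : G.Adj i j) : dist (x i) (x j) ≤ longestEdge x G := by
  refine le_csSup (Set.Finite.bddAbove ?_) ⟨i, j, h, rfl⟩
  refine (Set.finite_range fun q : Fin n × Fin n => dist (x q.1) (x q.2)).subset ?_
  rintro _ ⟨i, j, -, rfl⟩
  exact ⟨(i, j), rfl⟩

/-- In general position, two edges of a graph of the class with nearby endpoints coincide. -/
theorem eq_of_dist_lt {d n : ℕ} {x : Fin n → Pt d} (hx : GeneralPosition x)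
    {G : SimpleGraph (Fin n)} (hG : G ∈ localMSTClass x) {r : ℝ} {i i' y y' : Fin n}
    (h : G.Adj i y) (h' : G.Adj i' y') (hr : r ≤ dist (x i) (x y)) (hr' : r ≤ dist (x i') (x y'))
    (hi : dist (x i) (x i') < r) (hy : dist (x y) (x y') < r) : i = i' := by
  -- Both outer hops are shorter than `r`, hence than the edge, so the middle hop must attain the
  -- bound.
  have hle : dist (x i) (x y) ≤ dist (x i') (x y') := by
    have := hG i y i' y' h h'
    rw [dist_comm (x y')] at this
    grind
  have hle' : dist (x i') (x y') ≤ dist (x i) (x y) := by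
    have := hG i' y' i y h' h
    rw [dist_comm (x i') (x i)] at this
    grind
  by_contra hne
  by_cases hiy : i = y'
  · subst hiy
    rw [dist_comm] at hi
    exact (hi.trans_le hr').false
  · exact hx i y i' y' h.ne hne hiy (le_antisymm hle hle')

/-- A point lies in boundedly many balls of radius between `r` and `2r`. -/
theorem exists_scale_bound (d : ℕ) : ∃ K : ℕ, ∀ (n : ℕ) (x : Fin n → Pt d), GeneralPosition x →
    ∀ G ∈ localMSTClass x, ∀ (p : Pt d) (r : ℝ), 0 < r → ∀ s : Finset (Fin n),
      (∀ i ∈ s, p ∈ nodeBall x G i ∧ r ≤ radius x G i ∧ radius x G i < 2 * r) → s.card ≤ K := by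
  -- Centres lie within `2r` of `p` and the far ends of their longest edges within `4r`. After
  -- scaling by `1/r`, two points in one cell of radius `1/2` are less than `r` apart, so a pair of
  -- cells determines the centre.
  obtain ⟨t, -, htfin, ht⟩ := (isCompact_closedBall (0 : Pt d) 4).finite_cover_balls
    (show (0 : ℝ) < 1 / 2 by norm_num)
  refine ⟨(htfin.toFinset ×ˢ htfin.toFinset).card, fun n x hx G hG p r hr s hs => ?_⟩
  have hcell : ∀ q : Pt d, ∃ c, dist q p ≤ 4 * r → c ∈ t ∧ dist (r⁻¹ • (q - p)) c < 1 / 2 := by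
    intro q
    by_cases hq : dist q p ≤ 4 * r
    · have : r⁻¹ • (q - p) ∈ Metric.closedBall (0 : Pt d) 4 := by
        rw [mem_closedBall_zero_iff, norm_smul, Real.norm_of_nonneg (by positivity),
          ← dist_eq_norm, inv_mul_le_iff₀ hr]
        linarith
      obtain ⟨c, hc, hc'⟩ := Set.mem_iUnion₂.1 (ht this)
      exact ⟨c, fun _ => ⟨hc, hc'⟩⟩
    · exact ⟨0, fun h => absurd h hq⟩
  choose c hc using hcell
  have hclose : ∀ q q', dist q p ≤ 4 * r → dist q' p ≤ 4 * r → c q = c q' → dist q q' < r := by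
    intro q q' hq hq' h
    have h1 := (hc q hq).2
    have h2 := (hc q' hq').2
    rw [← h] at h2
    have h3 : dist (r⁻¹ • (q - p)) (r⁻¹ • (q' - p)) < 1 := by
      linarith [dist_triangle_right (r⁻¹ • (q - p)) (r⁻¹ • (q' - p)) (c q)]
    rw [dist_smul₀, dist_sub_right, Real.norm_of_nonneg (by positivity), inv_mul_lt_iff₀ hr] at h3
    linarith
  have hfar : ∀ i : Fin n, ∃ y, i ∈ s → G.Adj i y ∧ dist (x i) (x y) = radius x G i := by
    intro i
    by_cases hi : i ∈ s
    · obtain ⟨y, hy⟩ := exists_adj_dist_eq_radius x G (hr.trans_le (hs i hi).2.1)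
      exact ⟨y, fun _ => hy⟩
    · exact ⟨i, fun h => absurd h hi⟩
  choose y hy using hfar
  have h1 : ∀ i ∈ s, dist (x i) p ≤ 2 * r := fun i hi => by
    obtain ⟨h, -, h'⟩ := hs i hi
    rw [nodeBall, Metric.mem_closedBall, dist_comm] at h
    linarith
  have h2 : ∀ i ∈ s, dist (x (y i)) p ≤ 4 * r := fun i hi => by
    have := dist_triangle_left (x (y i)) p (x i)
    linarith [h1 i hi, (hy i hi).2, (hs i hi).2.2]
  have h1' : ∀ i ∈ s, dist (x i) p ≤ 4 * r := fun i hi => by linarith [h1 i hi]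
  refine Finset.card_le_card_of_injOn (fun i => (c (x i), c (x (y i)))) (fun i hi => ?_) ?_
  · simp only [Finset.coe_product, Set.Finite.coe_toFinset, Set.mem_prod]
    exact ⟨(hc _ (h1' i hi)).1, (hc _ (h2 i hi)).1⟩
  · intro i hi i' hi' h
    simp only [Prod.mk.injEq] at h
    refine eq_of_dist_lt hx hG (hy i hi).1 (hy i' hi').1 (r := r) ?_ ?_
      (hclose _ _ (h1' i hi) (h1' i' hi') h.1) (hclose _ _ (h2 i hi) (h2 i' hi') h.2)
    · rw [(hy i hi).2]; exact (hs i hi).2.1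
    · rw [(hy i' hi').2]; exact (hs i' hi').2.1

/-! ### Counting the occupied scales. -/

/-- If a point of the sample has no `m` nested neighbours at scale `τ`, then the nearby points
`i` whose distances are bounded by `τ 2^{-w i}` show fewer than `m` values of `w`. -/
theorem card_image_lt_of_not_hasNestedNeighbors {d n m : ℕ} {x : Fin n → Pt d} {τ : ℝ}
    (hτ : 0 ≤ τ) (hx : ¬ HasNestedNeighbors x τ m) (k : Fin n) (s : Finset (Fin n)) (hk : k ∉ s)
    (w : Fin n → ℕ) (hw : ∀ i ∈ s, dist (x i) (x k) ≤ τ * (1 / 2) ^ w i) :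
    (s.image w).card < m := by
  by_contra! h
  obtain ⟨u, hu, hcard⟩ := Finset.exists_subset_card_eq h
  let e := u.orderEmbOfFin hcard
  have hpre : ∀ j, ∃ i ∈ s, w i = e j := fun j =>
    Finset.mem_image.1 (hu (Finset.orderEmbOfFin_mem u hcard j))
  choose f hf hf' using hpre
  refine hx ⟨k, f, fun a b hab => e.injective ?_, fun j hj => hk (hj ▸ hf j), fun j => ?_⟩
  · rw [← hf', ← hf', hab]
  · refine (hw _ (hf j)).trans ?_
    have hj : (j : ℕ) ≤ w (f j) := by
      rw [hf']
      -- The `a`-th smallest of distinct naturals, counted from 0, is at least `a`.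
      have hmono : ∀ (a : ℕ) (ha : a < m), a ≤ e ⟨a, ha⟩ := by
        intro a
        induction a with
        | zero => intro _; exact Nat.zero_le _
        | succ a ih =>
          intro ha
          have h1 := ih (by omega)
          have h2 : e ⟨a, by omega⟩ < e ⟨a + 1, ha⟩ := e.strictMono (by simp [Fin.lt_def])
          omega
      exact hmono j j.2
    exact mul_le_mul_of_nonneg_left
      (pow_le_pow_of_le_one (by norm_num) (by norm_num) hj) hτ

/-- The deterministic bound: fewer than `m` scales below `τ`, and logarithmically many above. -/
theorem interference_le {d n m : ℕ} {K : ℕ} {x : Fin n → Pt d} {G : SimpleGraph (Fin n)} {τ : ℝ}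
    (hK : ∀ (p : Pt d) (r : ℝ), 0 < r → ∀ s : Finset (Fin n),
      (∀ i ∈ s, p ∈ nodeBall x G i ∧ r ≤ radius x G i ∧ radius x G i < 2 * r) → s.card ≤ K)
    (hinj : Function.Injective x) (hτ : 0 < τ) (hx : ¬ HasNestedNeighbors x τ m) :
    (interference x G : ℝ) ≤
      1 + K * (m + (Real.posLog (longestEdge x G / τ) / Real.log 2 + 1)) := by
  classical
  have hlog2 : 0 < Real.log 2 := Real.log_pos (by norm_num)
  have hbase : 0 ≤ 1 + K * (m + (Real.posLog (longestEdge x G / τ) / Real.log 2 + 1)) := by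
    have := Real.posLog_nonneg (x := longestEdge x G / τ)
    positivity
  suffices h : ∀ k, (interferenceAt x G (x k) : ℝ) ≤
      1 + K * (m + (Real.posLog (longestEdge x G / τ) / Real.log 2 + 1)) by
    have h' : interference x G ≤
        ⌊1 + K * (m + (Real.posLog (longestEdge x G / τ) / Real.log 2 + 1))⌋₊ :=
      Finset.sup_le fun k _ => Nat.le_floor (h k)
    exact (Nat.le_floor_iff hbase).1 h'
  intro k
  set s : Finset (Fin n) := Finset.univ.filter fun i => i ≠ k ∧ x k ∈ nodeBall x G i with hs
  have hcount : interferenceAt x G (x k) ≤ s.card + 1 := by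
    have hsub : {i : Fin n | x k ∈ nodeBall x G i} ⊆ ((insert k s : Finset (Fin n)) : Set _) := by
      intro i hi
      by_cases hik : i = k
      · simp [hik]
      · simp only [Finset.coe_insert, Set.mem_insert_iff, Finset.mem_coe]
        exact Or.inr (Finset.mem_filter.2 ⟨Finset.mem_univ _, hik, hi⟩)
    refine (Set.ncard_le_ncard hsub (Set.toFinite _)).trans ?_
    rw [Set.ncard_coe_finset]
    exact Finset.card_insert_le _ _
  have hdist : ∀ i ∈ s, dist (x i) (x k) ≤ radius x G i := fun i hi => by
    have := (Finset.mem_filter.1 hi).2.2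
    rwa [nodeBall, Metric.mem_closedBall, dist_comm] at this
  have hpos : ∀ i ∈ s, 0 < radius x G i := fun i hi =>
    (dist_pos.2 (hinj.ne (Finset.mem_filter.1 hi).2.1)).trans_le (hdist i hi)
  let z : Fin n → ℤ := fun i => Int.log 2 (radius x G i / τ)
  have hz1 : ∀ i ∈ s, τ * 2 ^ z i ≤ radius x G i := fun i hi => by
    have := Int.zpow_log_le_self (b := 2) (r := radius x G i / τ) one_lt_two
      (div_pos (hpos i hi) hτ)
    rwa [le_div_iff₀' hτ] at this
  have hz2 : ∀ i, radius x G i < τ * 2 ^ (z i + 1) := fun i => by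
    have := Int.lt_zpow_succ_log_self (b := 2) one_lt_two (radius x G i / τ)
    rwa [div_lt_iff₀' hτ] at this
  have hfib : ∀ s' ⊆ s, s'.card ≤ K * (s'.image z).card := fun s' hs' => by
    refine Finset.card_le_mul_card_image s' K fun b _ => ?_
    refine hK (x k) (τ * 2 ^ b) (by positivity) _ fun i hi => ?_
    obtain ⟨his, rfl⟩ := Finset.mem_filter.1 hi
    refine ⟨(Finset.mem_filter.1 (hs' his)).2.2, hz1 i (hs' his), (hz2 i).trans_eq ?_⟩
    rw [zpow_add_one₀ two_ne_zero]; ring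
  set sneg := s.filter fun i => z i < 0
  set spos := s.filter fun i => ¬ z i < 0
  have hsplit : sneg.card + spos.card = s.card := Finset.card_filter_add_card_filter_not _
  have hneg : (sneg.image z).card ≤ m := by
    -- The shift by one reflects the upper bound `radius < τ * 2 ^ (z + 1)`; the new exponent is a
    -- natural number since `z < 0`.
    have h1 : (sneg.image z).card = (sneg.image fun i => (-z i - 1).toNat).card := by
      rw [← Function.comp_def (fun a : ℤ => (-a - 1).toNat) z, ← Finset.image_image]
      symm
      refine Finset.card_image_of_injOn fun a ha b hb hab => ?_
      simp only [Finset.coe_image, Set.mem_image, Finset.mem_coe] at ha hb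
      obtain ⟨i, hi, rfl⟩ := ha
      obtain ⟨i', hi', rfl⟩ := hb
      have := (Finset.mem_filter.1 hi).2
      have := (Finset.mem_filter.1 hi').2
      omega
    rw [h1]
    refine (card_image_lt_of_not_hasNestedNeighbors hτ.le hx k sneg ?_ _ fun i hi => ?_).le
    · intro h
      exact (Finset.mem_filter.1 (Finset.mem_filter.1 h).1).2.1 rfl
    · obtain ⟨hi, hzi⟩ := Finset.mem_filter.1 hi
      refine (hdist i hi).trans ((hz2 i).le.trans_eq ?_)
      have : z i + 1 = -((-z i - 1).toNat : ℤ) := by omega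
      rw [this, zpow_neg, zpow_natCast, one_div, inv_pow]
  have hposi : ((spos.image z).card : ℝ) ≤
      Real.posLog (longestEdge x G / τ) / Real.log 2 + 1 := by
    have hsub : spos.image z ⊆ Finset.Icc 0
        ⌊Real.posLog (longestEdge x G / τ) / Real.log 2⌋ := by
      intro a ha
      obtain ⟨i, hi, rfl⟩ := Finset.mem_image.1 ha
      obtain ⟨hi, hzi⟩ := Finset.mem_filter.1 hi
      rw [Finset.mem_Icc, Int.le_floor, le_div_iff₀ hlog2]
      refine ⟨not_lt.1 hzi, ?_⟩
      obtain ⟨j, hj, hj'⟩ := exists_adj_dist_eq_radius x G (hpos i hi)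
      have h1 : (2 : ℝ) ^ z i ≤ longestEdge x G / τ := by
        rw [le_div_iff₀' hτ]
        exact (hz1 i hi).trans (hj' ▸ dist_le_longestEdge x G hj)
      have h2 := Real.log_le_log (by positivity) h1
      rw [Real.log_zpow] at h2
      exact h2.trans (le_max_right _ _)
    have h1 := Finset.card_le_card hsub
    rw [Int.card_Icc] at h1
    have hnn : 0 ≤ Real.posLog (longestEdge x G / τ) / Real.log 2 :=
      div_nonneg Real.posLog_nonneg hlog2.le
    have h0 : 0 ≤ ⌊Real.posLog (longestEdge x G / τ) / Real.log 2⌋ := Int.floor_nonneg.2 hnn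
    have h2 : ((spos.image z).card : ℤ) ≤
        ⌊Real.posLog (longestEdge x G / τ) / Real.log 2⌋ + 1 := by omega
    have h3 : ((spos.image z).card : ℝ) ≤
        (⌊Real.posLog (longestEdge x G / τ) / Real.log 2⌋ : ℝ) + 1 := by exact_mod_cast h2
    linarith [Int.floor_le (Real.posLog (longestEdge x G / τ) / Real.log 2)]
  have hneg' : (sneg.card : ℝ) ≤ K * m := by
    exact_mod_cast (hfib sneg (Finset.filter_subset _ _)).trans (Nat.mul_le_mul_left K hneg)
  have hpos' : (spos.card : ℝ) ≤ K * (Real.posLog (longestEdge x G / τ) / Real.log 2 + 1) := by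
    have : (spos.card : ℝ) ≤ K * (spos.image z).card := by
      exact_mod_cast hfib spos (Finset.filter_subset _ _)
    exact this.trans (mul_le_mul_of_nonneg_left hposi (Nat.cast_nonneg K))
  have hc : (interferenceAt x G (x k) : ℝ) ≤ sneg.card + spos.card + 1 := by
    exact_mod_cast hsplit ▸ hcount
  linarith

/-! ### Choice of parameters and conclusion. -/

/-- The exponent of `1/2` is at least `M² / 2 ≥ 2 log n`. The factor 2 in the choice of `M` suffices
because `2 log 2 > 1`. -/
theorem mul_half_pow_le (n : ℕ) (hn : 1 ≤ n) (M : ℕ) (hM : 2 * Real.sqrt (Real.log n) ≤ M) :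
    (n : ℝ) * (1 / 2) ^ ((M + 1) * (M + 1 - 1) / 2) ≤ (n : ℝ) ^ (-(2 * Real.log 2 - 1)) := by
  have hn0 : (0 : ℝ) < n := by exact_mod_cast hn
  have hlog : 0 ≤ Real.log n := Real.log_nonneg (by exact_mod_cast hn)
  set N := (M + 1) * (M + 1 - 1) / 2 with hN
  have hN2 : N * 2 = (M + 1) * M := by
    rw [hN, ← Finset.sum_range_id, Finset.sum_range_id_mul_two, Nat.add_sub_cancel]
  have hN2' : (N : ℝ) * 2 = (M + 1) * M := by exact_mod_cast hN2
  have h4 : 4 * Real.log n ≤ (M : ℝ) ^ 2 := by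
    calc 4 * Real.log n = (2 * Real.sqrt (Real.log n)) ^ 2 := by
          rw [mul_pow, Real.sq_sqrt hlog]; norm_num
      _ ≤ _ := by gcongr
  have hNlog : 2 * Real.log n ≤ N := by nlinarith [Nat.cast_nonneg (α := ℝ) M]
  have hlog2 : 0 < Real.log 2 := Real.log_pos one_lt_two
  have h1 : (1 / 2 : ℝ) ^ N = Real.exp (-(N * Real.log 2)) := by
    rw [← mul_neg, ← Real.log_inv, Real.exp_nat_mul, Real.exp_log (by norm_num), one_div]
  rw [h1, Real.rpow_def_of_pos hn0]
  nth_rw 1 [← Real.exp_log hn0]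
  rw [← Real.exp_add]
  apply Real.exp_le_exp.2
  nlinarith

end RandomInterference

open RandomInterference in
theorem theorem3 (d : ℕ) (hd : 1 ≤ d) :
    ∃ C : ℝ, 0 < C ∧
      Tendsto
        (fun n : ℕ =>
          RandomInterference.uniformSample d n
            {x | ∀ G ∈ RandomInterference.localMSTClass x,
              (RandomInterference.interference x G : ℝ) ≤
                C * (Real.sqrt (Real.log n) +
                  Real.posLog
                    (RandomInterference.longestEdge x G * (n : ℝ) ^ ((1 : ℝ) / (d : ℝ))))})
        atTop (𝓝 1) := by
  obtain ⟨ε, hε, hvol⟩ := exists_volume_closedBall_le d hd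
  obtain ⟨K, hK⟩ := exists_scale_bound d
  have hP : 0 ≤ Real.posLog ε⁻¹ := Real.posLog_nonneg
  -- The leading 1 pays for the vertex's own ball. The 5 comes from `M + 2 ≤ 2S + 3 ≤ 5S`, and the 2
  -- from `1 / log 2 ≤ 2`.
  refine ⟨1 + K * (5 + 2 * Real.posLog ε⁻¹), by positivity, ?_⟩
  set C := 1 + K * (5 + 2 * Real.posLog ε⁻¹) with hC
  have hlim : Tendsto (fun n : ℕ => 1 - ENNReal.ofReal ((n : ℝ) ^ (-(2 * Real.log 2 - 1))))
      atTop (𝓝 1) := by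
    have h1 : Tendsto (fun n : ℕ => (n : ℝ) ^ (-(2 * Real.log 2 - 1))) atTop (𝓝 0) :=
      (tendsto_rpow_neg_atTop (by linarith [Real.log_two_gt_d9])).comp tendsto_natCast_atTop_atTop
    have h2 := ENNReal.Tendsto.sub (tendsto_const_nhds (x := (1 : ENNReal)))
      (ENNReal.tendsto_ofReal h1) (Or.inl ENNReal.one_ne_top)
    simpa using h2
  refine tendsto_of_tendsto_of_tendsto_of_le_of_le' hlim tendsto_const_nhds ?_
    (Eventually.of_forall fun n => prob_le_one)
  -- From `n ≥ 3 > e` one gets `S ≥ 1`, which absorbs additive constants.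
  filter_upwards [eventually_ge_atTop 3] with n hn
  have hn0 : (0 : ℝ) < n := by exact_mod_cast (by omega : 0 < n)
  set S := Real.sqrt (Real.log n) with hS
  have hS1 : 1 ≤ S := by
    rw [hS, Real.one_le_sqrt, Real.le_log_iff_exp_le hn0]
    have : (3 : ℝ) ≤ n := by exact_mod_cast hn
    linarith [Real.exp_one_lt_d9]
  set M := ⌈2 * S⌉₊
  have hM : 2 * S ≤ M := Nat.le_ceil _
  have hM' : (M : ℝ) ≤ 2 * S + 1 := (Nat.ceil_lt_add_one (by positivity)).le
  set t := ((n : ℝ) ^ ((1 : ℝ) / d))⁻¹ with ht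
  have ht0 : 0 < t := by positivity
  have htd : t ^ d ≤ 1 / n := by
    rw [ht, inv_pow, ← Real.rpow_natCast, ← Real.rpow_mul hn0.le,
      one_div_mul_cancel (by positivity), Real.rpow_one, one_div]
  have hbad : uniformSample d n {x | HasNestedNeighbors x (ε * t) (M + 1)} ≤
      ENNReal.ofReal ((n : ℝ) ^ (-(2 * Real.log 2 - 1))) :=
    (uniformSample_hasNestedNeighbors_le d n (M + 1) hd ht0.le htd hvol).trans
      (ENNReal.ofReal_le_ofReal (mul_half_pow_le n (by omega) M hM))
  set A := {x : Fin n → Pt d | ∀ G ∈ localMSTClass x, (interference x G : ℝ) ≤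
    C * (S + Real.posLog (longestEdge x G * (n : ℝ) ^ ((1 : ℝ) / (d : ℝ))))} with hA
  -- Covering the whole space needs only monotonicity and subadditivity, so measurability of `A` is
  -- never required.
  have hcover : Set.univ ⊆ A ∪ ({x | ¬ GeneralPosition x} ∪
      {x | HasNestedNeighbors x (ε * t) (M + 1)}) := by
    intro x _
    by_cases hx : GeneralPosition x
    swap
    · exact Or.inr (Or.inl hx)
    by_cases hx' : HasNestedNeighbors x (ε * t) (M + 1)
    · exact Or.inr (Or.inr hx')
    refine Or.inl fun G hG => ?_
    have h1 := interference_le (hK n x hx G hG) hx.injective (by positivity) hx'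
    set L := Real.posLog (longestEdge x G * (n : ℝ) ^ ((1 : ℝ) / (d : ℝ)))
    have hL : 0 ≤ L := Real.posLog_nonneg
    have h2 : Real.posLog (longestEdge x G / (ε * t)) ≤ Real.posLog ε⁻¹ + L := by
      have : longestEdge x G / (ε * t) =
          ε⁻¹ * (longestEdge x G * (n : ℝ) ^ ((1 : ℝ) / (d : ℝ))) := by
        rw [ht]; field_simp
      rw [this]
      exact Real.posLog_mul
    have h3 : Real.posLog (longestEdge x G / (ε * t)) / Real.log 2 ≤
        2 * (Real.posLog ε⁻¹ + L) := by
      rw [div_le_iff₀ (Real.log_pos one_lt_two)]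
      nlinarith [Real.log_two_gt_d9]
    have h4 : ((M + 1 : ℕ) : ℝ) +
        (Real.posLog (longestEdge x G / (ε * t)) / Real.log 2 + 1) ≤
        (5 + 2 * Real.posLog ε⁻¹) * (S + L) := by
      push_cast
      nlinarith [mul_nonneg hP hL, mul_nonneg hP (sub_nonneg.2 hS1)]
    calc (interference x G : ℝ) ≤ _ := h1
      _ ≤ (S + L) + K * ((5 + 2 * Real.posLog ε⁻¹) * (S + L)) := by
          gcongr
          linarith
      _ = C * (S + L) := by rw [hC]; ring
  have huniv : (1 : ENNReal) ≤ uniformSample d n A +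
      ENNReal.ofReal ((n : ℝ) ^ (-(2 * Real.log 2 - 1))) := by
    calc (1 : ENNReal) = uniformSample d n Set.univ := measure_univ.symm
      _ ≤ _ := measure_mono hcover
      _ ≤ _ := measure_union_le _ _
      _ ≤ uniformSample d n A + (uniformSample d n {x | ¬ GeneralPosition x} +
          uniformSample d n {x | HasNestedNeighbors x (ε * t) (M + 1)}) := by
          gcongr
          exact measure_union_le _ _
      _ ≤ _ := by
          rw [uniformSample_not_generalPosition d n hd, zero_add]
          gcongr
  exact tsub_le_iff_right.2 huniv
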